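/- Let $\Sigma=\{l,r\}$. A nonempty word $w\in\Sigma^+$ is regarded as the finite structure whose elements are the positions of $w$, with their linear order $<$ and unary predicates $P_l,P_r$ for the positions carrying $l$ and $r$. Formulas of monadic second-order logic $\mathrm{MSO}$ are built from the atomic formulas $\top$, $\bot$, $x<y$, $x=y$, $P_l(x)$, $P_r(x)$, $U(x)$ ($x,y$ first-order variables, $U$ a set variable) by $\neg,\wedge,\vee$, by $\exists x,\forall x$ over positions and by $\exists U,\forall U$ over sets of positions; $\mathrm{FO}$ consists of the formulas in which no set variables occur. The size of a formula is given by $\mathrm{sz}(\varphi)=1$ for atomic $\varphi$, $\mathrm{sz}(\psi\wedge\theta)=\mathrm{sz}(\psi\vee\theta)=\mathrm{sz}(\psi)+\mathrm{sz}(\theta)+1$, and $\mathrm{sz}(\neg\psi)=\mathrm{sz}(\exists x\,\psi)=\mathrm{sz}(\forall x\,\psi)=\mathrm{sz}(\exists U\,\psi)=\mathrm{sz}(\forall U\,\psi)=\mathrm{sz}(\psi)+1$. $\mathrm{FO}[n]$ and $\mathrm{MSO}[n]$ are the sets of formulas of $\mathrm{FO}$, respectively $\mathrm{MSO}$, of size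 at most $n$. For a sentence $\varphi$ let $\mu(\varphi)$ be the least length of a word $w\in\Sigma^+$ with $w\models\varphi$ ($\mu(\varphi)=0$ if there is none), and let $\nu(\varphi)$ be the greatest length of a word $w\in\Sigma^+$ with $w\models\varphi$ ($\nu(\varphi)=0$ if there is no such word or if there are arbitrarily long ones). A sentence $\varphi$ defines $w\in\Sigma^+$ if $w$ is the only word in $\Sigma^+$ that satisfies $\varphi$. For a set $L$ of formulas let $\mathrm{DN}(L)$ be the maximum of the lengths $|w|$ of the words $w\in\Sigma^+$ that are defined by some sentence of $L$, and put $\mathrm{LS}(L)=\max\{\mu(\varphi)\mid\varphi\in L\text{ a sentence}\}$ and $\mathrm{H}(L)=\max\{\nu(\varphi)\mid\varphi\in L\text{ a sentence}\}$; the maximum of the empty set is taken to be $0$, and that of an unbounded set to be $\infty$. Let $\mathrm{tower}(0)=1$ and $\mathrm{tower}(m+1)=2^{\mathrm{tower}(m)}$ for $m\in\mathbb N$; for real $x\ge 0$ let $\mathrm{twr}(x)=\mathrm{tower}(\lceil x\rceil)$ and let $\log^*(x)$ be the smallest $m\in\mathbb N$ with $\mathrm{tower}(m)\ge x$. Then for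 every $n\in\mathbb N$, $$\mathrm{DN}(\mathrm{FO}[n]),\ \mathrm{LS}(\mathrm{FO}[n]),\ \mathrm{H}(\mathrm{FO}[n])\ \le\ \mathrm{twr}\bigl(n/2+\log^*((n/2)^2+n/2)+1\bigr)$$ and $$\mathrm{DN}(\mathrm{MSO}[n]),\ \mathrm{LS}(\mathrm{MSO}[n]),\ \mathrm{H}(\mathrm{MSO}[n])\ \le\ \mathrm{twr}\bigl(n/2+\log^*((n/2+1)^2)+1\bigr).$$ -/

import Mathlib

namespace WordLogic

/-- The two-letter alphabet `Σ = {l, r}`. -/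
inductive Letter : Type
  | l : Letter
  | r : Letter

/-- Words over `Σ`. The elements of `Σ⁺` are the words `w` with `w ≠ []`. -/
abbrev Word : Type := List Letter

/-- Formulas of monadic second-order logic over the vocabulary `{<, P_l, P_r}` of word models,
with equality. First-order variables and set variables are two separate countable supplies, both
indexed by `ℕ`. -/
inductive Formula : Type
  /-- The atomic formula `⊤`. -/
  | verum : Formula
  /-- The atomic formula `⊥`. -/
  | falsum : Formula
  /-- The atomic formula `x < y`. -/
  | lt (x y : ℕ) : Formula
  /-- The atomic formula `x = y`. -/
  | eq (x y : ℕ) : Formula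
  /-- The atomic formula `P_a(x)`. -/
  | letter (a : Letter) (x : ℕ) : Formula
  /-- The atomic formula `U(x)`, for a set variable `U`. -/
  | mem (U x : ℕ) : Formula
  | not (φ : Formula) : Formula
  | and (φ ψ : Formula) : Formula
  | or (φ ψ : Formula) : Formula
  /-- `∃ x φ`, first-order. -/
  | ex (x : ℕ) (φ : Formula) : Formula
  /-- `∀ x φ`, first-order. -/
  | all (x : ℕ) (φ : Formula) : Formula
  /-- `∃ U φ`, over sets. -/
  | exSet (U : ℕ) (φ : Formula) : Formula
  /-- `∀ U φ`, over sets. -/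
  | allSet (U : ℕ) (φ : Formula) : Formula

namespace Formula

/-- The size `sz(φ)`. -/
def size : Formula → ℕ
  | verum => 1
  | falsum => 1
  | lt _ _ => 1
  | eq _ _ => 1
  | letter _ _ => 1
  | mem _ _ => 1
  | not φ => φ.size + 1
  | and φ ψ => φ.size + ψ.size + 1
  | or φ ψ => φ.size + ψ.size + 1
  | ex _ φ => φ.size + 1
  | all _ φ => φ.size + 1
  | exSet _ φ => φ.size + 1
  | allSet _ φ => φ.size + 1

/-- First-order formulas: no set variable occurs, neither in an atom nor in a quantifier. -/
def IsFO : Formula → Prop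
  | verum => True
  | falsum => True
  | lt _ _ => True
  | eq _ _ => True
  | letter _ _ => True
  | mem _ _ => False
  | not φ => φ.IsFO
  | and φ ψ => φ.IsFO ∧ ψ.IsFO
  | or φ ψ => φ.IsFO ∧ ψ.IsFO
  | ex _ φ => φ.IsFO
  | all _ φ => φ.IsFO
  | exSet _ _ => False
  | allSet _ _ => False

/-- The free first-order variables. -/
def freeVars : Formula → Finset ℕ
  | verum => ∅
  | falsum => ∅
  | lt x y => {x, y}
  | eq x y => {x, y}
  | letter _ x => {x}
  | mem _ x => {x}
  | not φ => φ.freeVars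
  | and φ ψ => φ.freeVars ∪ ψ.freeVars
  | or φ ψ => φ.freeVars ∪ ψ.freeVars
  | ex x φ => φ.freeVars.erase x
  | all x φ => φ.freeVars.erase x
  | exSet _ φ => φ.freeVars
  | allSet _ φ => φ.freeVars

/-- The free set variables. -/
def freeSetVars : Formula → Finset ℕ
  | verum => ∅
  | falsum => ∅
  | lt _ _ => ∅
  | eq _ _ => ∅
  | letter _ _ => ∅
  | mem U _ => {U}
  | not φ => φ.freeSetVars
  | and φ ψ => φ.freeSetVars ∪ ψ.freeSetVars
  | or φ ψ => φ.freeSetVars ∪ ψ.freeSetVars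
  | ex _ φ => φ.freeSetVars
  | all _ φ => φ.freeSetVars
  | exSet U φ => φ.freeSetVars.erase U
  | allSet U φ => φ.freeSetVars.erase U

/-- A sentence is a formula without free variables of either kind. -/
def IsSentence (φ : Formula) : Prop :=
  φ.freeVars = ∅ ∧ φ.freeSetVars = ∅

/-- Satisfaction in the word model of `w`, whose elements are the positions of `w`, under an
assignment `p` of positions to first-order variables and `P` of sets of positions to set
variables. -/
def Realize (w : Word) :
    Formula → (ℕ → Fin w.length) → (ℕ → Set (Fin w.length)) → Prop
  | verum, _, _ => True
  | falsum, _, _ => False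
  | lt x y, p, _ => p x < p y
  | eq x y, p, _ => p x = p y
  | letter a x, p, _ => w.get (p x) = a
  | mem U x, p, P => p x ∈ P U
  | not φ, p, P => ¬ φ.Realize w p P
  | and φ ψ, p, P => φ.Realize w p P ∧ ψ.Realize w p P
  | or φ ψ, p, P => φ.Realize w p P ∨ ψ.Realize w p P
  | ex x φ, p, P => ∃ i : Fin w.length, φ.Realize w (Function.update p x i) P
  | all x φ, p, P => ∀ i : Fin w.length, φ.Realize w (Function.update p x i) P
  | exSet U φ, p, P => ∃ A : Set (Fin w.length), φ.Realize w p (Function.update P U A)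
  | allSet U φ, p, P => ∀ A : Set (Fin w.length), φ.Realize w p (Function.update P U A)

end Formula

/-- `w ⊨ φ`. It is only used for sentences `φ` and nonempty words `w`; there assignments exist and
the truth of `φ` does not depend on which one is taken. -/
def Models (w : Word) (φ : Formula) : Prop :=
  ∀ (p : ℕ → Fin w.length) (P : ℕ → Set (Fin w.length)), φ.Realize w p P

/-- The sentence `φ` defines the word `w ∈ Σ⁺`. -/
def Defines (φ : Formula) (w : Word) : Prop :=
  Models w φ ∧ ∀ v : Word, v ≠ [] → v ≠ w → ¬ Models v φ

/-- `Def(L)`, the set of words in `Σ⁺` that are defined by some sentence of `L`. -/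
def Def (L : Set Formula) : Set Word :=
  {w | w ≠ [] ∧ ∃ φ ∈ L, φ.IsSentence ∧ Defines φ w}

/-- The set of lengths of the models of `φ` in `Σ⁺`. -/
def modelLengths (φ : Formula) : Set ℕ :=
  {m | ∃ w : Word, w ≠ [] ∧ Models w φ ∧ w.length = m}

/-- `μ(φ)`: the least length of a model of `φ`, and `0` if `φ` has no model
(the infimum of the empty set of natural numbers is `0`). -/
noncomputable def mu (φ : Formula) : ℕ :=
  sInf (modelLengths φ)

open Classical in
/-- `ν(φ)`: the greatest length of a model of `φ`, and `0` if `φ` has no model or has arbitrarily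
long models. -/
noncomputable def nu (φ : Formula) : ℕ :=
  if (modelLengths φ).Nonempty ∧ BddAbove (modelLengths φ) then sSup (modelLengths φ) else 0

/-- The definability number of `L`. Here and in the next two definitions the maximum is formed as
a supremum in `ℕ∞`: it is the maximum whenever the set of values is nonempty and bounded, it is
`⊤` if the set is unbounded, and `0` if the set is empty. -/
noncomputable def DN (L : Set Formula) : ℕ∞ :=
  ⨆ w ∈ Def L, (w.length : ℕ∞)

/-- The Löwenheim-Skolem number of `L`. -/
noncomputable def LS (L : Set Formula) : ℕ∞ :=
  ⨆ φ ∈ {φ ∈ L | φ.IsSentence}, (mu φ : ℕ∞)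

/-- The Hanf number of `L`. -/
noncomputable def H (L : Set Formula) : ℕ∞ :=
  ⨆ φ ∈ {φ ∈ L | φ.IsSentence}, (nu φ : ℕ∞)

/-- The size `n` fragment `MSO[n]`. -/
def MSOSize (n : ℕ) : Set Formula :=
  {φ | φ.size ≤ n}

/-- The size `n` fragment `FO[n]`. -/
def FOSize (n : ℕ) : Set Formula :=
  {φ | φ.IsFO ∧ φ.size ≤ n}

/-- The exponential tower on the natural numbers. -/
def tower : ℕ → ℕ
  | 0 => 1
  | n + 1 => 2 ^ tower n

/-- `twr(x) = tower(⌈x⌉)` for `x ≥ 0`. -/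
noncomputable def twr (x : ℝ) : ℕ :=
  tower ⌈x⌉₊

/-- `log*(x)`: the least `m ∈ ℕ` with `tower(m) ≥ x` (there always is one). -/
noncomputable def logStar (x : ℝ) : ℕ :=
  sInf {m : ℕ | x ≤ (tower m : ℝ)}

end WordLogic

namespace WordLogic

/-! The proof is a pumping argument on Ehrenfeucht-Fraïssé types. An atom has at most two variables,
so many useful quantifiers force many atoms and connectives: a sentence of size at most `n` has
effective rank at most `k = (n + 1) / 2`, which is `⌈n/2⌉` (`two_mul_effRank_add_card_le`). Such a
sentence cannot separate words between which Duplicator survives `k` rounds (`EF.realize_iff`), and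
appending a common suffix preserves Duplicator's win (`EF.append`).

The `k`-round type of a word is coded in a `k`-fold iterated power set of the `k × m` bit matrices
(`ef_of_code_eq`), so there are at most `tower (k + L + 1)` types if `k * m ≤ tower L`
(`card_code_le`). Here `m = k` suffices for FO; MSO takes one more column, telling set moves from
position moves.

In a model longer than the number of types, two distinct nonempty prefixes share a type. Replacing
the longer by the shorter gives a smaller model, the converse exchange a larger one. Smaller models
bound `DN` and `LS`, larger ones bound `H`. -/

theorem exists_iff_and_forall_iff {α β : Sort*} {p : α → Prop} {q : β → Prop}
    (forth : ∀ a, ∃ b, (p a ↔ q b)) (back : ∀ b, ∃ a, (p a ↔ q b)) :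
    ((∃ a, p a) ↔ ∃ b, q b) ∧ ((∀ a, p a) ↔ ∀ b, q b) := by
  refine ⟨⟨fun ⟨a, ha⟩ => ?_, fun ⟨b, hb⟩ => ?_⟩, ⟨fun h b => ?_, fun h a => ?_⟩⟩
  · exact (forth a).imp fun b hb => hb.mp ha
  · exact (back b).imp fun a ha => ha.mpr hb
  · obtain ⟨a, ha⟩ := back b
    exact ha.mp (h a)
  · obtain ⟨b, hb⟩ := forth a
    exact hb.mpr (h b)

/-! ### Quantifier rank against formula size -/

namespace Formula

/-- The quantifier rank, where quantifiers that bind no occurrence of their variable are not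
counted. -/
def effRank : Formula → ℕ
  | verum => 0
  | falsum => 0
  | lt _ _ => 0
  | eq _ _ => 0
  | letter _ _ => 0
  | mem _ _ => 0
  | not φ => φ.effRank
  | and φ ψ => max φ.effRank ψ.effRank
  | or φ ψ => max φ.effRank ψ.effRank
  | ex x φ => if x ∈ φ.freeVars then φ.effRank + 1 else φ.effRank
  | all x φ => if x ∈ φ.freeVars then φ.effRank + 1 else φ.effRank
  | exSet U φ => if U ∈ φ.freeSetVars then φ.effRank + 1 else φ.effRank
  | allSet U φ => if U ∈ φ.freeSetVars then φ.effRank + 1 else φ.effRank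

/-- Counting free variables makes the induction work: a counted quantifier adds 2 to the first term,
paid by one unit of size and one variable that ceases to be free. At a binary connective, the extra
unit of size supplies the second `+ 1`. -/
theorem two_mul_effRank_add_card_le (φ : Formula) :
    2 * φ.effRank + φ.freeVars.card + φ.freeSetVars.card ≤ φ.size + 1 := by
  induction φ with
  | verum | falsum | letter => simp [effRank, freeVars, freeSetVars, size]
  | mem => simp [effRank, freeVars, freeSetVars, size]
  | lt x y | eq x y =>
    simp only [effRank, freeVars, freeSetVars, size, Finset.card_empty]
    have := Finset.card_le_two (a := x) (b := y)
    omega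
  | not φ ih => simp only [effRank, freeVars, freeSetVars, size]; omega
  | and φ ψ ih₁ ih₂ | or φ ψ ih₁ ih₂ =>
    simp only [effRank, freeVars, freeSetVars, size]
    have h₁ := Finset.card_union_le φ.freeVars ψ.freeVars
    have h₂ := Finset.card_union_le φ.freeSetVars ψ.freeSetVars
    omega
  | ex x φ ih | all x φ ih =>
    simp only [effRank, freeVars, freeSetVars, size]
    split_ifs with h
    · have := Finset.card_erase_add_one h
      omega
    · rw [Finset.erase_eq_of_notMem h]
      omega
  | exSet x φ ih | allSet x φ ih =>
    simp only [effRank, freeVars, freeSetVars, size]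
    split_ifs with h
    · have := Finset.card_erase_add_one h
      omega
    · rw [Finset.erase_eq_of_notMem h]
      omega

end Formula

/-! ### Ehrenfeucht-Fraïssé games -/

/-- Pairs of positions of two words. -/
abbrev PosRel (w w' : Word) : Type := Set (Fin w.length × Fin w'.length)

/-- Pairs of sets of positions of two words. -/
abbrev SetRel (w w' : Word) : Type := Set (Set (Fin w.length) × Set (Fin w'.length))

/-- The pairs in `R` and `Q` form a partial isomorphism of the word models. -/
def PartialIso (w w' : Word) (R : PosRel w w') (Q : SetRel w w') : Prop :=
  (∀ x ∈ R, w.get x.1 = w'.get x.2) ∧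
  (∀ x ∈ R, ∀ y ∈ R, (x.1 < y.1 ↔ x.2 < y.2)) ∧
  (∀ x ∈ R, ∀ X ∈ Q, (x.1 ∈ X.1 ↔ x.2 ∈ X.2))

/-- Duplicator wins the `j`-round Ehrenfeucht-Fraïssé game from the given position. Set moves are
allowed if `S` holds. -/
def EF (S : Prop) (w w' : Word) : ℕ → PosRel w w' → SetRel w w' → Prop
  | 0, R, Q => PartialIso w w' R Q
  | j + 1, R, Q =>
    (∀ i, ∃ i', EF S w w' j (insert (i, i') R) Q) ∧
    (∀ i', ∃ i, EF S w w' j (insert (i, i') R) Q) ∧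
    (S → ∀ A, ∃ A', EF S w w' j R (insert (A, A') Q)) ∧
    (S → ∀ A', ∃ A, EF S w w' j R (insert (A, A') Q))

variable {S : Prop} {w w' u u' v : Word} {j : ℕ}

theorem EF.anti {R R' : PosRel w w'} {Q Q' : SetRel w w'} (h : EF S w w' j R Q)
    (hR : R' ⊆ R) (hQ : Q' ⊆ Q) : EF S w w' j R' Q' := by
  induction j generalizing R R' Q Q' with
  | zero =>
    exact ⟨fun x hx => h.1 x (hR hx), fun x hx y hy => h.2.1 x (hR hx) y (hR hy),
      fun x hx X hX => h.2.2 x (hR hx) X (hQ hX)⟩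
  | succ j ih =>
    obtain ⟨h₁, h₂, h₃, h₄⟩ := h
    refine ⟨fun i => ?_, fun i => ?_, fun s A => ?_, fun s A => ?_⟩
    · obtain ⟨i', hi⟩ := h₁ i
      exact ⟨i', ih hi (Set.insert_subset_insert hR) hQ⟩
    · obtain ⟨i', hi⟩ := h₂ i
      exact ⟨i', ih hi (Set.insert_subset_insert hR) hQ⟩
    · obtain ⟨A', hA⟩ := h₃ s A
      exact ⟨A', ih hA hR (Set.insert_subset_insert hQ)⟩
    · obtain ⟨A', hA⟩ := h₄ s A
      exact ⟨A', ih hA hR (Set.insert_subset_insert hQ)⟩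

/-- A round is wasted by playing an arbitrary position and forgetting the pair, hence the need for a
position in `w`. -/
theorem EF.pred {R : PosRel w w'} {Q : SetRel w w'} (hw : 0 < w.length)
    (h : EF S w w' (j + 1) R Q) : EF S w w' j R Q := by
  obtain ⟨i', hi⟩ := h.1 ⟨0, hw⟩
  exact hi.anti (Set.subset_insert _ _) le_rfl

theorem EF.of_le {R : PosRel w w'} {Q : SetRel w w'} (hw : 0 < w.length) {k : ℕ} (hjk : j ≤ k)
    (h : EF S w w' k R Q) : EF S w w' j R Q := by
  induction hjk with
  | refl => exact h
  | step _ ih => exact ih (h.pred hw)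

theorem EF.partialIso {R : PosRel w w'} {Q : SetRel w w'} (hw : 0 < w.length)
    (h : EF S w w' j R Q) : PartialIso w w' R Q :=
  h.of_le hw (Nat.zero_le j)

/-- Formulas of effective rank at most `j` do not distinguish positions in which Duplicator wins
the `j`-round game. -/
theorem EF.realize_iff {R : PosRel w w'} {Q : SetRel w w'} (φ : Formula) (hS : S ∨ φ.IsFO)
    (h : EF S w w' j R Q) (hj : φ.effRank ≤ j)
    (p : ℕ → Fin w.length) (P : ℕ → Set (Fin w.length))
    (p' : ℕ → Fin w'.length) (P' : ℕ → Set (Fin w'.length))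
    (hp : ∀ x ∈ φ.freeVars, (p x, p' x) ∈ R) (hP : ∀ U ∈ φ.freeSetVars, (P U, P' U) ∈ Q) :
    φ.Realize w p P ↔ φ.Realize w' p' P' := by
  have hw : 0 < w.length := (p 0).pos
  induction φ generalizing j R Q p P p' P' with
  | verum | falsum => rfl
  | lt x y =>
    exact (h.partialIso hw).2.1 _ (hp x (by simp [Formula.freeVars])) _
      (hp y (by simp [Formula.freeVars]))
  | eq x y =>
    have hx := hp x (by simp [Formula.freeVars])
    have hy := hp y (by simp [Formula.freeVars])
    have h₁ := (h.partialIso hw).2.1 _ hx _ hy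
    have h₂ := (h.partialIso hw).2.1 _ hy _ hx
    -- Equality in a linear order means that neither element is below the other, so `PartialIso`
    -- needs no clause for it.
    simp only [Formula.Realize, le_antisymm_iff, ← not_lt]
    simp only at h₁ h₂
    rw [h₁, h₂]
  | letter a x =>
    have := (h.partialIso hw).1 _ (hp x (by simp [Formula.freeVars]))
    simp only [Formula.Realize]
    rw [this]
  | mem U x =>
    exact (h.partialIso hw).2.2 _ (hp x (by simp [Formula.freeVars])) _
      (hP U (by simp [Formula.freeSetVars]))
  | not φ ih => exact not_congr (ih hS h hj p P p' P' hp hP)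
  | and φ ψ ih₁ ih₂ =>
    have hj' := max_le_iff.mp hj
    exact and_congr
      (ih₁ (hS.imp_right (·.1)) h hj'.1 p P p' P' (fun x hx => hp x (Finset.mem_union_left _ hx))
        (fun x hx => hP x (Finset.mem_union_left _ hx)))
      (ih₂ (hS.imp_right (·.2)) h hj'.2 p P p' P' (fun x hx => hp x (Finset.mem_union_right _ hx))
        (fun x hx => hP x (Finset.mem_union_right _ hx)))
  | or φ ψ ih₁ ih₂ =>
    have hj' := max_le_iff.mp hj
    exact or_congr
      (ih₁ (hS.imp_right (·.1)) h hj'.1 p P p' P' (fun x hx => hp x (Finset.mem_union_left _ hx))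
        (fun x hx => hP x (Finset.mem_union_left _ hx)))
      (ih₂ (hS.imp_right (·.2)) h hj'.2 p P p' P' (fun x hx => hp x (Finset.mem_union_right _ hx))
        (fun x hx => hP x (Finset.mem_union_right _ hx)))
  | ex x φ ih | all x φ ih =>
    simp only [Formula.effRank] at hj
    simp only [Formula.Realize]
    split_ifs at hj with hx
    · obtain ⟨j, rfl⟩ : ∃ m, j = m + 1 := ⟨j - 1, by omega⟩
      have key : ∀ i i', EF S w w' j (insert (i, i') R) Q →
          (φ.Realize w (Function.update p x i) P ↔ φ.Realize w' (Function.update p' x i') P') := by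
        intro i i' hi
        refine ih hS hi (by omega) _ P _ P' (fun y hy => ?_) hP
        by_cases hyx : y = x
        · subst hyx; simp
        · simpa [hyx] using Or.inr (hp y (Finset.mem_erase.mpr ⟨hyx, hy⟩))
      have forth : ∀ i, ∃ i', (φ.Realize w (Function.update p x i) P ↔
          φ.Realize w' (Function.update p' x i') P') := fun i =>
        (h.1 i).imp fun i' => key i i'
      have back : ∀ i', ∃ i, (φ.Realize w (Function.update p x i) P ↔
          φ.Realize w' (Function.update p' x i') P') := fun i' =>
        (h.2.1 i').imp fun i => key i i'
      first
      | exact (exists_iff_and_forall_iff forth back).1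
      | exact (exists_iff_and_forall_iff forth back).2
    -- A vacuous quantifier consumes no round: any two values of its variable may be paired.
    · have key : ∀ i i', (φ.Realize w (Function.update p x i) P ↔
          φ.Realize w' (Function.update p' x i') P') := by
        intro i i'
        refine ih hS h hj _ P _ P' (fun y hy => ?_) hP
        have hyx : y ≠ x := fun e => hx (e ▸ hy)
        simpa [hyx] using hp y (Finset.mem_erase.mpr ⟨hyx, hy⟩)
      first
      | exact (exists_iff_and_forall_iff (fun i => ⟨p' 0, key i _⟩) (fun i' => ⟨p 0, key _ i'⟩)).1
      | exact (exists_iff_and_forall_iff (fun i => ⟨p' 0, key i _⟩) (fun i' => ⟨p 0, key _ i'⟩)).2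
  | exSet x φ ih | allSet x φ ih =>
    simp only [Formula.effRank] at hj
    simp only [Formula.Realize]
    have hS' : S := hS.resolve_right id
    split_ifs at hj with hx
    · obtain ⟨j, rfl⟩ : ∃ m, j = m + 1 := ⟨j - 1, by omega⟩
      have key : ∀ i i', EF S w w' j R (insert (i, i') Q) →
          (φ.Realize w p (Function.update P x i) ↔ φ.Realize w' p' (Function.update P' x i')) := by
        intro i i' hi
        refine ih (Or.inl hS') hi (by omega) p _ p' _ hp (fun y hy => ?_)
        by_cases hyx : y = x
        · subst hyx; simp
        · simpa [hyx] using Or.inr (hP y (Finset.mem_erase.mpr ⟨hyx, hy⟩))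
      have forth : ∀ i, ∃ i', (φ.Realize w p (Function.update P x i) ↔
          φ.Realize w' p' (Function.update P' x i')) := fun i =>
        (h.2.2.1 hS' i).imp fun i' => key i i'
      have back : ∀ i', ∃ i, (φ.Realize w p (Function.update P x i) ↔
          φ.Realize w' p' (Function.update P' x i')) := fun i' =>
        (h.2.2.2 hS' i').imp fun i => key i i'
      first
      | exact (exists_iff_and_forall_iff forth back).1
      | exact (exists_iff_and_forall_iff forth back).2
    · have key : ∀ i i', (φ.Realize w p (Function.update P x i) ↔
          φ.Realize w' p' (Function.update P' x i')) := by
        intro i i'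
        refine ih (Or.inl hS') h hj p _ p' _ hp (fun y hy => ?_)
        have hyx : y ≠ x := fun e => hx (e ▸ hy)
        simpa [hyx] using hP y (Finset.mem_erase.mpr ⟨hyx, hy⟩)
      first
      | exact (exists_iff_and_forall_iff (fun i => ⟨P' 0, key i _⟩) (fun i' => ⟨P 0, key _ i'⟩)).1
      | exact (exists_iff_and_forall_iff (fun i => ⟨P' 0, key i _⟩) (fun i' => ⟨P 0, key _ i'⟩)).2

theorem EF.models {φ : Formula} (hφ : φ.IsSentence) (hS : S ∨ φ.IsFO) (hw : w ≠ [])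
    (h : EF S w w' j ∅ ∅) (hj : φ.effRank ≤ j) (hm : Models w φ) : Models w' φ := by
  intro p' P'
  have p : ℕ → Fin w.length := fun _ => ⟨0, List.length_pos_iff.mpr hw⟩
  refine (h.realize_iff φ hS hj p (fun _ => ∅) p' P' ?_ ?_).mp (hm _ _)
  · simp [hφ.1]
  · simp [hφ.2]

/-! ### Composition with a common suffix -/

/-- The relation on positions of `u ++ v` and `u' ++ v` given by `R` on the prefixes and the
identity on `v`. -/
def gluePos (u u' v : Word) (R : PosRel u u') : PosRel (u ++ v) (u' ++ v) :=
  {a | (∃ x ∈ R, a.1.val = x.1.val ∧ a.2.val = x.2.val) ∨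
    ∃ q < v.length, a.1.val = u.length + q ∧ a.2.val = u'.length + q}

/-- The relation on sets of positions of `u ++ v` and `u' ++ v` given by `Q` on the prefixes and
the identity on `v`. -/
def glueSet (u u' v : Word) (Q : SetRel u u') : SetRel (u ++ v) (u' ++ v) :=
  {A | (∃ X ∈ Q, (∀ a x, a.val = x.val → (a ∈ A.1 ↔ x ∈ X.1)) ∧
      (∀ a x, a.val = x.val → (a ∈ A.2 ↔ x ∈ X.2))) ∧
    ∀ a a' q, a.val = u.length + q → a'.val = u'.length + q → (a ∈ A.1 ↔ a' ∈ A.2)}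

theorem glueSet_insert {Q : SetRel u u'} {A : Set (Fin (u ++ v).length)}
    {A' : Set (Fin (u' ++ v).length)} {X : Set (Fin u.length)} {X' : Set (Fin u'.length)}
    (h : ∀ a x, a.val = x.val → (a ∈ A ↔ x ∈ X)) (h' : ∀ a x, a.val = x.val → (a ∈ A' ↔ x ∈ X'))
    (hv : ∀ a a' q, a.val = u.length + q → a'.val = u'.length + q → (a ∈ A ↔ a' ∈ A')) :
    insert (A, A') (glueSet u u' v Q) ⊆ glueSet u u' v (insert (X, X') Q) := by
  rintro B (rfl | hB)
  · exact ⟨⟨(X, X'), Set.mem_insert _ _, h, h'⟩, hv⟩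
  · obtain ⟨⟨Y, hY, hYs⟩, hB⟩ := hB
    exact ⟨⟨Y, Set.mem_insert_of_mem _ hY, hYs⟩, hB⟩

theorem gluePos_insert {R : PosRel u u'} {a : Fin (u ++ v).length} {a' : Fin (u' ++ v).length}
    {x : Fin u.length} {x' : Fin u'.length} (h : a.val = x.val) (h' : a'.val = x'.val) :
    insert (a, a') (gluePos u u' v R) ⊆ gluePos u u' v (insert (x, x') R) := by
  rintro B (rfl | ⟨y, hy, hB⟩ | hB)
  · exact Or.inl ⟨_, Set.mem_insert _ _, h, h'⟩
  · exact Or.inl ⟨y, Set.mem_insert_of_mem _ hy, hB⟩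
  · exact Or.inr hB

theorem PartialIso.append {R : PosRel u u'} {Q : SetRel u u'} (h : PartialIso u u' R Q) :
    PartialIso (u ++ v) (u' ++ v) (gluePos u u' v R) (glueSet u u' v Q) := by
  obtain ⟨h₁, h₂, h₃⟩ := h
  refine ⟨?_, ?_, ?_⟩
  · rintro ⟨a, a'⟩ (⟨⟨x, x'⟩, hx, e, e'⟩ | ⟨q, hq, e, e'⟩)
    · have := h₁ _ hx
      simp only at e e' this
      simp only [List.get_eq_getElem, e, e'] at this ⊢
      rw [List.getElem_append_left x.2, List.getElem_append_left x'.2, this]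
    · simp only at e e'
      simp only [List.get_eq_getElem, e, e']
      rw [List.getElem_append_right (by omega), List.getElem_append_right (by omega)]
      simp
  · rintro ⟨a, a'⟩ (⟨⟨x, x'⟩, hx, e, e'⟩ | ⟨q, hq, e, e'⟩) ⟨b, b'⟩
      (⟨⟨y, y'⟩, hy, f, f'⟩ | ⟨r, hr, f, f'⟩)
    · have := h₂ _ hx _ hy
      simp only [Fin.lt_def] at *
      omega
    all_goals
      simp only [Fin.lt_def] at *
      omega
  · rintro ⟨a, a'⟩ (⟨⟨x, x'⟩, hx, e, e'⟩ | ⟨q, hq, e, e'⟩) ⟨A, A'⟩ ⟨⟨⟨X, X'⟩, hX, k, k'⟩, hA⟩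
    · have := h₃ _ hx _ hX
      simp only at *
      rw [k a x e, k' a' x' e', this]
    · exact hA a a' q e e'

/-- Extends a set of positions of `u'` to `u' ++ v`, copying the `v`-part of `A`. -/
def transfer (u u' v : Word) (X : Set (Fin u'.length)) (A : Set (Fin (u ++ v).length)) :
    Set (Fin (u' ++ v).length) :=
  {a | (∃ x ∈ X, a.val = x.val) ∨ ∃ q, a.val = u'.length + q ∧ ∃ b ∈ A, b.val = u.length + q}

theorem mem_transfer_left {X : Set (Fin u'.length)} {A : Set (Fin (u ++ v).length)}
    (a : Fin (u' ++ v).length) (x : Fin u'.length) (h : a.val = x.val) :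
    a ∈ transfer u u' v X A ↔ x ∈ X := by
  constructor
  · rintro (⟨y, hy, e⟩ | ⟨q, e, -⟩)
    · rwa [Fin.ext (h.symm.trans e)]
    · omega
  · exact fun hx => Or.inl ⟨x, hx, h⟩

theorem mem_transfer_right {X : Set (Fin u'.length)} {A : Set (Fin (u ++ v).length)}
    (a : Fin (u ++ v).length) (a' : Fin (u' ++ v).length) (q : ℕ) (h : a.val = u.length + q)
    (h' : a'.val = u'.length + q) : a' ∈ transfer u u' v X A ↔ a ∈ A := by
  constructor
  · rintro (⟨y, hy, e⟩ | ⟨r, e, b, hb, e'⟩)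
    · omega
    · rwa [show a = b from Fin.ext (by omega)]
  · exact fun ha => Or.inr ⟨q, h', a, ha, h⟩

/-- Duplicator follows the given strategy on the prefixes and copies Spoiler on `v`; a set move is
split into its two parts, and the answers are merged by `transfer`. -/
theorem EF.append {R : PosRel u u'} {Q : SetRel u u'} (hu : 0 < u.length)
    (h : EF S u u' j R Q) :
    EF S (u ++ v) (u' ++ v) j (gluePos u u' v R) (glueSet u u' v Q) := by
  induction j generalizing R Q with
  | zero => exact PartialIso.append h
  | succ j ih =>
    refine ⟨fun a => ?_, fun a => ?_, fun s A => ?_, fun s A => ?_⟩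
    · by_cases ha : a.val < u.length
      · obtain ⟨x', hx⟩ := h.1 ⟨a, ha⟩
        exact ⟨⟨x', by simp only [List.length_append]; omega⟩,
          (ih hx).anti (gluePos_insert rfl rfl) le_rfl⟩
      · have ha' := a.2
        simp only [List.length_append] at ha'
        refine ⟨⟨u'.length + (a - u.length), by simp only [List.length_append]; omega⟩,
          (ih (h.pred hu)).anti (Set.insert_subset ?_ le_rfl) le_rfl⟩
        exact Or.inr ⟨a - u.length, by omega, by simp only; omega, rfl⟩
    · by_cases ha : a.val < u'.length
      · obtain ⟨x', hx⟩ := h.2.1 ⟨a, ha⟩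
        exact ⟨⟨x', by simp only [List.length_append]; omega⟩,
          (ih hx).anti (gluePos_insert rfl rfl) le_rfl⟩
      · have ha' := a.2
        simp only [List.length_append] at ha'
        refine ⟨⟨u.length + (a - u'.length), by simp only [List.length_append]; omega⟩,
          (ih (h.pred hu)).anti (Set.insert_subset ?_ le_rfl) le_rfl⟩
        exact Or.inr ⟨a - u'.length, by omega, rfl, by simp only; omega⟩
    · obtain ⟨X', hX⟩ := h.2.2.1 s {x | ∃ a ∈ A, a.val = x.val}
      refine ⟨transfer u u' v X' A, (ih hX).anti le_rfl (glueSet_insert ?_ mem_transfer_left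
        fun a a' q e e' => (mem_transfer_right a a' q e e').symm)⟩
      exact fun a x e => ⟨fun ha => ⟨a, ha, e⟩, fun ⟨b, hb, e'⟩ =>
        (Fin.ext (e.trans e'.symm) : a = b) ▸ hb⟩
    · obtain ⟨X, hX⟩ := h.2.2.2 s {x | ∃ a ∈ A, a.val = x.val}
      refine ⟨transfer u' u v X A, (ih hX).anti le_rfl (glueSet_insert mem_transfer_left ?_
        fun a a' q e e' => mem_transfer_right a' a q e' e)⟩
      exact fun a x e => ⟨fun ha => ⟨a, ha, e⟩, fun ⟨b, hb, e'⟩ =>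
        (Fin.ext (e.trans e'.symm) : a = b) ▸ hb⟩

/-! ### Coding game types by iterated power sets -/

/-- A move in a game on `w`: a position or a set of positions. -/
abbrev Move (w : Word) : Type := Fin w.length ⊕ Set (Fin w.length)

/-- Iterated power sets of the set of `k × m` bit matrices. -/
def Code (k m : ℕ) : ℕ → Type
  | 0 => Set (Fin k × Fin m)
  | j + 1 => Set (Code k m j)

instance Code.finite (k m j : ℕ) : Finite (Code k m j) := by
  induction j with
  | zero => exact inferInstanceAs (Finite (Set (Fin k × Fin m)))
  | succ j ih => exact inferInstanceAs (Finite (Set (Code k m j)))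

/-- The entries of the matrix describing a list of `k` moves: letters on the diagonal, the kinds of
the moves in column `k`, order and membership elsewhere. -/
def entry (k : ℕ) (ms : List (Move w)) (a b : ℕ) : Prop :=
  if b = k then ∃ A, ms[a]? = some (Sum.inr A)
  else if a = b then ∃ i, ms[a]? = some (Sum.inl i) ∧ w.get i = Letter.l
  else ∃ i, ms[a]? = some (Sum.inl i) ∧
    ((∃ i', ms[b]? = some (Sum.inl i') ∧ i < i') ∨ ∃ A, ms[b]? = some (Sum.inr A) ∧ i ∈ A)

/-- The `j`-round type of a list of moves. -/
def code (S : Prop) (k m : ℕ) : (j : ℕ) → List (Move w) → Code k m j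
  | 0, ms => {x : Fin k × Fin m | entry k ms x.1 x.2}
  | j + 1, ms => {c : Code k m j | (∃ i, code S k m j (Sum.inl i :: ms) = c) ∨
      S ∧ ∃ A, code S k m j (Sum.inr A :: ms) = c}

/-- The pairs of positions chosen in the same round. -/
def posPairs (ms : List (Move w)) (ms' : List (Move w')) : PosRel w w' :=
  {x | (Sum.inl x.1, Sum.inl x.2) ∈ ms.zip ms'}

/-- The pairs of sets chosen in the same round. -/
def setPairs (ms : List (Move w)) (ms' : List (Move w')) : SetRel w w' :=
  {X | (Sum.inr X.1, Sum.inr X.2) ∈ ms.zip ms'}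

theorem EF.cons_pos {ms : List (Move w)} {ms' : List (Move w')} {i : Fin w.length}
    {i' : Fin w'.length}
    (h : EF S w w' j (posPairs (Sum.inl i :: ms) (Sum.inl i' :: ms'))
      (setPairs (Sum.inl i :: ms) (Sum.inl i' :: ms'))) :
    EF S w w' j (insert (i, i') (posPairs ms ms')) (setPairs ms ms') := by
  refine h.anti ?_ fun X hX => List.mem_cons_of_mem _ hX
  rintro x (rfl | hx)
  · exact List.mem_cons_self
  · exact List.mem_cons_of_mem _ hx

theorem EF.cons_set {ms : List (Move w)} {ms' : List (Move w')} {A : Set (Fin w.length)}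
    {A' : Set (Fin w'.length)}
    (h : EF S w w' j (posPairs (Sum.inr A :: ms) (Sum.inr A' :: ms'))
      (setPairs (Sum.inr A :: ms) (Sum.inr A' :: ms'))) :
    EF S w w' j (posPairs ms ms') (insert (A, A') (setPairs ms ms')) := by
  refine h.anti (fun X hX => List.mem_cons_of_mem _ hX) ?_
  rintro x (rfl | hx)
  · exact List.mem_cons_self
  · exact List.mem_cons_of_mem _ hx

theorem exists_getElem?_of_mem_zip {α β : Type*} {l : List α} {l' : List β} {x : α × β}
    (h : x ∈ l.zip l') : ∃ a < l.length, l[a]? = some x.1 ∧ l'[a]? = some x.2 := by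
  obtain ⟨a, ha, rfl⟩ := List.getElem_of_mem h
  simp only [List.length_zip, lt_inf_iff] at ha
  exact ⟨a, ha.1, by simp [ha.1], by simp [ha.2]⟩

theorem partialIso_of_entry {k : ℕ} {ms : List (Move w)} {ms' : List (Move w')}
    (hk : ms.length = k)
    (h : ∀ a < k, ∀ b < k, entry k ms a b ↔ entry k ms' a b) :
    PartialIso w w' (posPairs ms ms') (setPairs ms ms') := by
  refine ⟨?_, ?_, ?_⟩
  · rintro ⟨i, i'⟩ hi
    obtain ⟨a, ha, e, e'⟩ := exists_getElem?_of_mem_zip hi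
    have := h a (by omega) a (by omega)
    simp only [entry, e, e', if_neg (show a ≠ k by omega), if_true, Option.some.injEq,
      Sum.inl.injEq, exists_eq_left'] at this
    simp only
    -- With only two letters, the single bit "is `l`" determines the letter.
    cases hl : w.get i <;> cases hl' : w'.get i' <;> simp_all
  · rintro ⟨i, i'⟩ hi ⟨q, q'⟩ hq
    obtain ⟨a, ha, e, e'⟩ := exists_getElem?_of_mem_zip hi
    obtain ⟨b, hb, f, f'⟩ := exists_getElem?_of_mem_zip hq
    by_cases hab : a = b
    · subst hab
      simp_all
    · have := h a (by omega) b (by omega)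
      simpa [entry, e, e', f, f', if_neg (show b ≠ k by omega), hab] using this
  · rintro ⟨i, i'⟩ hi ⟨A, A'⟩ hA
    obtain ⟨a, ha, e, e'⟩ := exists_getElem?_of_mem_zip hi
    obtain ⟨b, hb, f, f'⟩ := exists_getElem?_of_mem_zip hA
    have hab : a ≠ b := by
      rintro rfl
      simp_all
    have := h a (by omega) b (by omega)
    simpa [entry, e, e', f, f', if_neg (show b ≠ k by omega), hab] using this

theorem kinds_eq_of_entry {k : ℕ} {ms : List (Move w)} {ms' : List (Move w')}
    (hk : ms.length = k) (hk' : ms'.length = k)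
    (h : ∀ a < k, entry k ms a k ↔ entry k ms' a k) :
    ms.map Sum.isLeft = ms'.map Sum.isLeft := by
  refine List.ext_getElem (by simp [hk, hk']) fun a ha ha' => ?_
  simp only [List.length_map] at ha ha'
  have := h a (by omega)
  simp only [entry, if_true, List.getElem?_eq_getElem ha, List.getElem?_eq_getElem ha',
    Option.some.injEq] at this
  simp only [List.getElem_map]
  cases h₁ : ms[a] <;> cases h₂ : ms'[a] <;> simp_all

/-- A code puts the types after position moves and after set moves into one set, which saves a
disjoint union per level. The induction therefore also carries equality of the kinds of moves, read
off column `k` of the final matrix, to ensure that moves are answered by moves of the same kind. -/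
theorem ef_of_code_eq {k m : ℕ} (hkm : k ≤ m) (hS : S → k < m) (hw : 0 < w.length)
    (ms : List (Move w)) (ms' : List (Move w')) (hl : ms.length + j = k)
    (hl' : ms'.length + j = k)
    (h : code S k m j ms = code S k m j ms') :
    EF S w w' j (posPairs ms ms') (setPairs ms ms') ∧
      (S → ms.map Sum.isLeft = ms'.map Sum.isLeft) := by
  induction j generalizing ms ms' with
  | zero =>
    have key : ∀ a < k, ∀ b < m, entry k ms a b ↔ entry k ms' a b := fun a ha b hb =>
      Set.ext_iff.mp h (⟨a, ha⟩, ⟨b, hb⟩)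
    exact ⟨partialIso_of_entry hl fun a ha b hb => key a ha b (by omega),
      fun s => kinds_eq_of_entry hl hl' fun a ha => key a ha k (hS s)⟩
  | succ j ih =>
    have hc := Set.ext_iff.mp h
    have forth : ∀ i, ∃ i', EF S w w' j (insert (i, i') (posPairs ms ms')) (setPairs ms ms') ∧
        (S → ms.map Sum.isLeft = ms'.map Sum.isLeft) := by
      intro i
      obtain ⟨i', hi⟩ | ⟨s, A, hA⟩ := (hc _).mp (Or.inl ⟨i, rfl⟩)
      · have := ih (Sum.inl i :: ms) (Sum.inl i' :: ms') (by simp; omega) (by simp; omega) hi.symm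
        exact ⟨i', this.1.cons_pos, fun s => by simpa using this.2 s⟩
      -- A set cannot share its code with a position: the kinds of the newest moves would differ.
      · have := ih (Sum.inl i :: ms) (Sum.inr A :: ms') (by simp; omega) (by simp; omega) hA.symm
        simpa using this.2 s
    refine ⟨⟨fun i => (forth i).imp fun _ h => h.1, fun i' => ?_, fun s A => ?_, fun s A' => ?_⟩,
      -- The kinds of the earlier moves agree because they still agree after one more move.
      (forth ⟨0, hw⟩).choose_spec.2⟩
    · obtain ⟨i, hi⟩ | ⟨s, A, hA⟩ := (hc _).mpr (Or.inl ⟨i', rfl⟩)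
      · have := ih (Sum.inl i :: ms) (Sum.inl i' :: ms') (by simp; omega) (by simp; omega) hi
        exact ⟨i, this.1.cons_pos⟩
      · have := ih (Sum.inr A :: ms) (Sum.inl i' :: ms') (by simp; omega) (by simp; omega) hA
        simpa using this.2 s
    · obtain ⟨i', hi⟩ | ⟨_, A', hA⟩ := (hc _).mp (Or.inr ⟨s, A, rfl⟩)
      · have := ih (Sum.inr A :: ms) (Sum.inl i' :: ms') (by simp; omega) (by simp; omega) hi.symm
        simpa using this.2 s
      · have := ih (Sum.inr A :: ms) (Sum.inr A' :: ms') (by simp; omega) (by simp; omega) hA.symm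
        exact ⟨A', this.1.cons_set⟩
    · obtain ⟨i, hi⟩ | ⟨_, A, hA⟩ := (hc _).mpr (Or.inr ⟨s, A', rfl⟩)
      · have := ih (Sum.inl i :: ms) (Sum.inr A' :: ms') (by simp; omega) (by simp; omega) hi
        simpa using this.2 s
      · have := ih (Sum.inr A :: ms) (Sum.inr A' :: ms') (by simp; omega) (by simp; omega) hA
        exact ⟨A, this.1.cons_set⟩

theorem ef_append_of_code_eq {k m : ℕ} (hkm : k ≤ m) (hS : S → k < m) (hu : 0 < u.length)
    (h : code S k m k ([] : List (Move u)) = code S k m k ([] : List (Move u'))) :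
    EF S (u ++ v) (u' ++ v) k ∅ ∅ :=
  ((ef_of_code_eq hkm hS hu [] [] (by simp) (by simp) h).1.append hu).anti
    (Set.empty_subset _) (Set.empty_subset _)

/-! ### Counting types and pumping -/

theorem tower_strictMono : StrictMono tower :=
  strictMono_nat_of_lt_succ fun _ => Nat.lt_two_pow_self

/-- The matrices number `2 ^ (k * m)`, which costs the `+ 1` in the height; each power set raises
the height by one. -/
theorem card_code_le {k m L : ℕ} (h : k * m ≤ tower L) (j : ℕ) :
    Nat.card (Code k m j) ≤ tower (j + L + 1) := by
  induction j with
  | zero =>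
    have : Nat.card (Code k m 0) = 2 ^ (k * m) := by
      simp [Code, Nat.card_eq_fintype_card]
    rw [this, zero_add]
    exact Nat.pow_le_pow_right two_pos h
  | succ j ih =>
    have := Fintype.ofFinite (Code k m j)
    have : Nat.card (Code k m (j + 1)) = 2 ^ Nat.card (Code k m j) := by
      change Nat.card (Set (Code k m j)) = _
      rw [Nat.card_eq_fintype_card, Nat.card_eq_fintype_card, Fintype.card_set]
    rw [this, show j + 1 + L + 1 = (j + L + 1) + 1 by omega]
    exact Nat.pow_le_pow_right two_pos ih

/-- Pumping: a model that is longer than the number of types has two prefixes of the same type. -/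
theorem exists_shorter_and_longer_model {k m : ℕ} (hkm : k ≤ m) (hS : S → k < m) {φ : Formula}
    (hφ : φ.IsSentence) (hFO : S ∨ φ.IsFO) (hk : φ.effRank ≤ k) (hm : Models w φ)
    (hlen : Nat.card (Code k m k) < w.length) :
    (∃ v, v ≠ [] ∧ Models v φ ∧ v.length < w.length) ∧
      ∃ v, v ≠ [] ∧ Models v φ ∧ w.length < v.length := by
  have := Fintype.ofFinite (Code k m k)
  obtain ⟨a, b, hab, hc⟩ := Fintype.exists_ne_map_eq_of_card_lt
    -- The shift `a + 1` keeps only nonempty prefixes, as `EF.append` requires, and still gives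
    -- `w.length` of them.
    (fun a : Fin w.length => code S k m k ([] : List (Move (w.take (a + 1)))))
    (by rwa [Fintype.card_fin, ← Nat.card_eq_fintype_card])
  wlog hlt : a < b generalizing a b
  · exact this b a hab.symm hc.symm (lt_of_le_of_ne (not_lt.mp hlt) hab.symm)
  have hlt' : a.val < b.val := hlt
  have hb := b.2
  have hwne : w ≠ [] := List.length_pos_iff.mp (by omega)
  have h₁ : EF S (w.take (b + 1) ++ w.drop (b + 1)) (w.take (a + 1) ++ w.drop (b + 1)) k ∅ ∅ :=
    ef_append_of_code_eq hkm hS (by simp) hc.symm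
  have h₂ : EF S (w.take (a + 1) ++ w.drop (a + 1)) (w.take (b + 1) ++ w.drop (a + 1)) k ∅ ∅ :=
    ef_append_of_code_eq hkm hS (by simp) hc
  rw [List.take_append_drop] at h₁ h₂
  refine ⟨⟨_, ?_, h₁.models hφ hFO hwne hk hm, ?_⟩, ⟨_, ?_, h₂.models hφ hFO hwne hk hm, ?_⟩⟩
  · simp [hwne]
  · simp; omega
  · simp [hwne]
  · simp; omega

/-- The three numbers of a fragment are bounded as soon as models beyond the bound can be both
shortened and lengthened. -/
theorem numbers_le_of_pumping {L : Set Formula} {N : ℕ}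
    (h : ∀ φ ∈ L, φ.IsSentence → ∀ w, Models w φ → N < w.length →
      (∃ v, v ≠ [] ∧ Models v φ ∧ v.length < w.length) ∧
        ∃ v, v ≠ [] ∧ Models v φ ∧ w.length < v.length) :
    DN L ≤ N ∧ LS L ≤ N ∧ H L ≤ N := by
  refine ⟨iSup₂_le ?_, iSup₂_le ?_, iSup₂_le ?_⟩
  · rintro w ⟨-, φ, hφ, hs, hm, huniq⟩
    by_contra hlt
    rw [not_le, Nat.cast_lt] at hlt
    obtain ⟨v, hv, hvm, hlen⟩ := (h φ hφ hs w hm hlt).1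
    exact huniq v hv (fun e => by simp [e] at hlen) hvm
  · rintro φ ⟨hφ, hs⟩
    by_contra hlt
    rw [not_le, Nat.cast_lt] at hlt
    -- A positive `mu φ` is not the default value, so it is attained by a model.
    obtain ⟨w, -, hm, hw⟩ := Nat.sInf_mem (Nat.nonempty_of_pos_sInf (pos_of_gt hlt))
    change w.length = mu φ at hw
    obtain ⟨v, hv, hvm, hlen⟩ := (h φ hφ hs w hm (hw ▸ hlt)).1
    have : mu φ ≤ v.length := Nat.sInf_le ⟨v, hv, hvm, rfl⟩
    omega
  · rintro φ ⟨hφ, hs⟩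
    by_contra hlt
    rw [not_le, Nat.cast_lt, nu] at hlt
    split_ifs at hlt with hb
    · obtain ⟨w, -, hm, hw⟩ := Nat.sSup_mem hb.1 hb.2
      obtain ⟨v, hv, hvm, hlen⟩ := (h φ hφ hs w hm (hw ▸ hlt)).2
      have := le_csSup hb.2 ⟨v, hv, hvm, rfl⟩
      omega
    · omega

/-! ### Numerical bounds -/

theorem le_tower_logStar (x : ℝ) : x ≤ (tower (logStar x) : ℝ) := by
  refine Nat.sInf_mem (s := {m : ℕ | x ≤ (tower m : ℝ)}) ?_
  obtain ⟨m, hm⟩ := exists_nat_ge x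
  exact ⟨m, hm.trans (Nat.cast_le.mpr tower_strictMono.le_apply)⟩

theorem tower_le_twr (n L : ℕ) :
    tower ((n + 1) / 2 + L + 1) ≤ twr ((n : ℝ) / 2 + (L : ℝ) + 1) := by
  -- Reading `≤` as `<` after dropping the final `+ 1`, it remains that `(n + 1) / 2 < n / 2 + 1`,
  -- with floor division on the left and real division on the right.
  refine tower_strictMono.monotone (Nat.lt_ceil.mpr ?_)
  have h : ((((n + 1) / 2 : ℕ) * 2 : ℕ) : ℝ) ≤ (n + 1 : ℕ) :=
    Nat.cast_le.mpr (Nat.div_mul_le_self _ _)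
  push_cast at h ⊢
  linarith

theorem numbers_le_twr {Fr : Set Formula} {n m L : ℕ} (hsize : ∀ φ ∈ Fr, φ.size ≤ n)
    (hFO : ∀ φ ∈ Fr, S ∨ φ.IsFO) (hm : (n + 1) / 2 ≤ m) (hS : S → (n + 1) / 2 < m)
    (hL : (n + 1) / 2 * m ≤ tower L) :
    DN Fr ≤ (twr ((n : ℝ) / 2 + (L : ℝ) + 1) : ℕ∞) ∧
      LS Fr ≤ (twr ((n : ℝ) / 2 + (L : ℝ) + 1) : ℕ∞) ∧
      H Fr ≤ (twr ((n : ℝ) / 2 + (L : ℝ) + 1) : ℕ∞) := by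
  refine numbers_le_of_pumping fun φ hφ hs w hw hlen => ?_
  have h₁ := φ.two_mul_effRank_add_card_le
  have h₂ := hsize φ hφ
  exact exists_shorter_and_longer_model hm hS hs (hFO φ hφ) (by omega) hw
    ((card_code_le hL _).trans_lt ((tower_le_twr n L).trans_lt hlen))

/-- With `k = (n + 1) / 2`, one has `4 * k ^ 2 ≤ n ^ 2 + 2 * n + 1 ≤ 4 * T + 1`; divisibility by 4
absorbs the last unit. -/
theorem sq_half_succ_le (n : ℕ) :
    (n + 1) / 2 * ((n + 1) / 2) ≤ tower (logStar (((n : ℝ) / 2) ^ 2 + (n : ℝ) / 2)) := by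
  have h := le_tower_logStar (((n : ℝ) / 2) ^ 2 + (n : ℝ) / 2)
  set T := tower (logStar (((n : ℝ) / 2) ^ 2 + (n : ℝ) / 2))
  have h' : n ^ 2 + 2 * n ≤ 4 * T := by
    have : (n : ℝ) ^ 2 + 2 * n ≤ 4 * T := by linarith
    exact_mod_cast this
  have hk : 2 * ((n + 1) / 2) ≤ n + 1 := Nat.mul_div_le _ _
  have : (2 * ((n + 1) / 2)) ^ 2 ≤ (n + 1) ^ 2 := Nat.pow_le_pow_left hk 2
  have : 4 * ((n + 1) / 2 * ((n + 1) / 2)) ≤ n ^ 2 + 2 * n + 1 := by linarith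
  omega

/-- Here `4 * k * (k + 1) < (2 * k + 1) ^ 2 ≤ (n + 2) ^ 2 ≤ 4 * T`. -/
theorem half_succ_mul_succ_le (n : ℕ) :
    (n + 1) / 2 * ((n + 1) / 2 + 1) ≤ tower (logStar (((n : ℝ) / 2 + 1) ^ 2)) := by
  have h := le_tower_logStar (((n : ℝ) / 2 + 1) ^ 2)
  set T := tower (logStar (((n : ℝ) / 2 + 1) ^ 2))
  have h' : (n + 2) ^ 2 ≤ 4 * T := by
    have : ((n : ℝ) + 2) ^ 2 ≤ 4 * T := by linarith
    exact_mod_cast this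
  have hk : 2 * ((n + 1) / 2) ≤ n + 1 := Nat.mul_div_le _ _
  have : (2 * ((n + 1) / 2) + 1) ^ 2 ≤ (n + 2) ^ 2 := Nat.pow_le_pow_left (by omega) 2
  linarith

end WordLogic



theorem corollary4 (n : ℕ) :
    (WordLogic.DN (WordLogic.FOSize n) ≤
        (WordLogic.twr ((n : ℝ) / 2 +
          (WordLogic.logStar (((n : ℝ) / 2) ^ 2 + (n : ℝ) / 2) : ℝ) + 1) : ℕ∞) ∧
      WordLogic.LS (WordLogic.FOSize n) ≤
        (WordLogic.twr ((n : ℝ) / 2 +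
          (WordLogic.logStar (((n : ℝ) / 2) ^ 2 + (n : ℝ) / 2) : ℝ) + 1) : ℕ∞) ∧
      WordLogic.H (WordLogic.FOSize n) ≤
        (WordLogic.twr ((n : ℝ) / 2 +
          (WordLogic.logStar (((n : ℝ) / 2) ^ 2 + (n : ℝ) / 2) : ℝ) + 1) : ℕ∞)) ∧
    (WordLogic.DN (WordLogic.MSOSize n) ≤
        (WordLogic.twr ((n : ℝ) / 2 +
          (WordLogic.logStar (((n : ℝ) / 2 + 1) ^ 2) : ℝ) + 1) : ℕ∞) ∧
      WordLogic.LS (WordLogic.MSOSize n) ≤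
        (WordLogic.twr ((n : ℝ) / 2 +
          (WordLogic.logStar (((n : ℝ) / 2 + 1) ^ 2) : ℝ) + 1) : ℕ∞) ∧
      WordLogic.H (WordLogic.MSOSize n) ≤
        (WordLogic.twr ((n : ℝ) / 2 +
          (WordLogic.logStar (((n : ℝ) / 2 + 1) ^ 2) : ℝ) + 1) : ℕ∞)) := by
  -- FO uses games without set moves and `m = k`; MSO allows them and takes `m = k + 1`.
  exact ⟨WordLogic.numbers_le_twr (S := False) (fun φ hφ => hφ.2) (fun φ hφ => Or.inr hφ.1)
      le_rfl False.elim (WordLogic.sq_half_succ_le n),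
    WordLogic.numbers_le_twr (S := True) (fun φ hφ => hφ) (fun φ _ => Or.inl trivial)
      (Nat.le_succ _) (fun _ => Nat.lt_succ_self _) (WordLogic.half_succ_mul_succ_le n)⟩
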